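/- Let $\Omega\subset\mathbb R^d$ be a bounded open set (for instance a bounded Lipschitz domain), $T>0$, $0<\alpha<1$, and let $\rho,c,\tau_q>0$, $a\ge 0$ be constants. Let $k\in L^\infty(\Omega)^{d\times d}$ be symmetric and uniformly elliptic: there is $\tilde k>0$ with $\xi^\top k(x)\xi\ge\tilde k\|\xi\|^2$ for a.e. $x\in\Omega$ and all $\xi\in\mathbb R^d$. Write $(\cdot,\cdot)$ for the $L^2(\Omega)$ inner product, let $H^1_0(\Omega)$ be the closure of $C_c^\infty(\Omega)$ in the $H^1$ norm, let $\langle\cdot,\cdot\rangle$ be the duality pairing between $H^{-1}(\Omega)=H^1_0(\Omega)^*$ and $H^1_0(\Omega)$, extending $(\cdot,\cdot)$, and put $$\mathcal L(v,\varphi)=(k\nabla v,\nabla\varphi)+a(v,\varphi),\qquad g_\alpha(t)=\frac{t^{-\alpha}}{\Gamma(1-\alpha)},\qquad (g_\alpha*z)(t)=\int_0^t g_\alpha(t-s)z(s)\,ds .$$ Let $F:(0,T)\to L^2(\Omega)$ and $U_0,V_0\in L^2(\Omega)$ be given. A weak solution of the single-phase-lag problem is a function $u\in L^\infty((0,T),H^1_0(\Omega))\cap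 C([0,T],L^2(\Omega))$ with $u(0)=U_0$ whose weak time derivatives satisfy $\partial_t u\in L^2((0,T),L^2(\Omega))$ and $\partial_t\big(g_\alpha*(\partial_t u-V_0)\big)\in L^2((0,T),H^{-1}(\Omega))$, such that for a.e. $t\in(0,T)$ and all $\varphi\in H^1_0(\Omega)$ $$\rho c\,\tau_q^\alpha\big\langle\partial_t\big(g_\alpha*(\partial_t u-V_0)\big)(t),\varphi\big\rangle+a\,\tau_q^\alpha\big((g_\alpha*\partial_t u)(t),\varphi\big)+\rho c\,(\partial_t u(t),\varphi)+\mathcal L(u(t),\varphi)=(F(t),\varphi).$$ Theorem (Uniqueness SPL). If $u_1$ and $u_2$ are two weak solutions for the same data $F,U_0,V_0$ and $\partial_t u_1,\partial_t u_2\in L^\infty((0,T),L^2(\Omega))$, then $u_1(t)=u_2(t)$ in $L^2(\Omega)$ for every $t\in[0,T]$. -/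

import Mathlib

open MeasureTheory Set
open scoped ContDiff InnerProductSpace ENNReal

noncomputable section

namespace SPL

/-- The space `ℝᵈ` with its Euclidean norm. -/
abbrev Space (d : ℕ) : Type := EuclideanSpace ℝ (Fin d)

/-- `L²(Ω)`, real valued. -/
abbrev L2 {d : ℕ} (Ω : Set (Space d)) : Type :=
  Lp ℝ 2 (volume.restrict Ω)

/-- `L²(Ω)ᵈ`, the space of square integrable vector fields on `Ω`. -/
abbrev L2Vec {d : ℕ} (Ω : Set (Space d)) : Type :=
  Lp (Space d) 2 (volume.restrict Ω)

/-- `φ ∈ C_c^∞(Ω)`. -/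
structure IsTestFunction {E : Type*} [NormedAddCommGroup E] [NormedSpace ℝ E]
    (Ω : Set E) (φ : E → ℝ) : Prop where
  contDiff : ContDiff ℝ ∞ φ
  hasCompactSupport : HasCompactSupport φ
  tsupport_subset : tsupport φ ⊆ Ω

/-- The pairs `(φ, ∇φ)`, `φ ∈ C_c^∞(Ω)`, in `L²(Ω) × L²(Ω)ᵈ`. The norm of a pair in this
Hilbert product is the `H¹(Ω)` norm of `φ`. -/
def testGraph {d : ℕ} (Ω : Set (Space d)) : Submodule ℝ (WithLp 2 (L2 Ω × L2Vec Ω)) where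
  carrier := {p | ∃ φ : Space d → ℝ, IsTestFunction Ω φ ∧
    p.fst =ᵐ[volume.restrict Ω] φ ∧ p.snd =ᵐ[volume.restrict Ω] gradient φ}
  zero_mem' := by
    refine ⟨fun _ => 0, ⟨contDiff_const, HasCompactSupport.zero, ?_⟩, ?_, ?_⟩
    · simp [tsupport]
    · exact Lp.coeFn_zero _ _ _
    · refine (Lp.coeFn_zero _ _ _).trans (Filter.Eventually.of_forall fun x => ?_)
      simp [gradient]
  add_mem' := by
    rintro p q ⟨φ, hφ, hp1, hp2⟩ ⟨ψ, hψ, hq1, hq2⟩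
    refine ⟨φ + ψ, ⟨hφ.contDiff.add hψ.contDiff,
      hφ.hasCompactSupport.add hψ.hasCompactSupport,
      (tsupport_add φ ψ).trans (union_subset hφ.tsupport_subset hψ.tsupport_subset)⟩, ?_, ?_⟩
    · exact (Lp.coeFn_add _ _).trans (hp1.add hq1)
    · refine (Lp.coeFn_add _ _).trans ((hp2.add hq2).trans
        (Filter.Eventually.of_forall fun x => ?_))
      have h1 := (hφ.contDiff.differentiable (by simp)) x
      have h2 := (hψ.contDiff.differentiable (by simp)) x
      simp [gradient, fderiv_add h1 h2]
  smul_mem' := by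
    rintro r p ⟨φ, hφ, hp1, hp2⟩
    refine ⟨r • φ, ⟨contDiff_const.smul hφ.contDiff, hφ.hasCompactSupport.smul_left,
      (closure_mono (Function.support_const_smul_subset r φ)).trans hφ.tsupport_subset⟩, ?_, ?_⟩
    · exact (Lp.coeFn_smul _ _).trans (hp1.const_smul r)
    · refine (Lp.coeFn_smul _ _).trans ((hp2.const_smul r).trans
        (Filter.Eventually.of_forall fun x => ?_))
      have h1 := (hφ.contDiff.differentiable (by simp)) x
      simp [gradient, fderiv_const_smul h1 r]

/-- `H¹₀(Ω)`, the closure of `C_c^∞(Ω)` in the `H¹` norm `(‖v‖² + ‖∇v‖²)^(1/2)`. An element is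
stored as the pair `(v, ∇v)` of the function and its (weak) gradient. -/
abbrev H10 {d : ℕ} (Ω : Set (Space d)) : Type :=
  ↥(testGraph Ω).topologicalClosure

/-- The inclusion `H¹₀(Ω) → L²(Ω)`. -/
def H10.val {d : ℕ} {Ω : Set (Space d)} : H10 Ω →L[ℝ] L2 Ω :=
  (WithLp.fstL 2 ℝ (L2 Ω) (L2Vec Ω)).comp (testGraph Ω).topologicalClosure.subtypeL

/-- The weak gradient `∇ : H¹₀(Ω) → L²(Ω)ᵈ`. -/
def H10.grad {d : ℕ} {Ω : Set (Space d)} : H10 Ω →L[ℝ] L2Vec Ω :=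
  (WithLp.sndL 2 ℝ (L2 Ω) (L2Vec Ω)).comp (testGraph Ω).topologicalClosure.subtypeL

/-- The dual space `H¹₀(Ω)* = H⁻¹(Ω)`. -/
abbrev Hneg1 {d : ℕ} (Ω : Set (Space d)) : Type := H10 Ω →L[ℝ] ℝ

/-- The embedding `L²(Ω) → H¹₀(Ω)*`, `h ↦ (φ ↦ (h, φ))`, for which the duality pairing extends
the `L²(Ω)` inner product. -/
def L2.toDual {d : ℕ} {Ω : Set (Space d)} (h : L2 Ω) : Hneg1 Ω :=
  (innerSL ℝ h).comp H10.val

/-- The Riemann–Liouville kernel `g_γ(t) = t^(-γ) / Γ(1-γ)`. -/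
def rlKernel (γ t : ℝ) : ℝ := t ^ (-γ) / Real.Gamma (1 - γ)

/-- The Laplace convolution `(κ ∗ z)(t) = ∫₀ᵗ κ(t-s) z(s) ds` (Bochner integral). -/
def laplaceConv {X : Type*} [NormedAddCommGroup X] [NormedSpace ℝ X]
    (κ : ℝ → ℝ) (z : ℝ → X) (t : ℝ) : X :=
  ∫ s in (0 : ℝ)..t, κ (t - s) • z s

/-- `f'` is the weak (distributional) derivative of `f` on `(0,T)`, for functions with values in
a Banach space. -/
structure IsWeakTimeDeriv {X : Type*} [NormedAddCommGroup X] [NormedSpace ℝ X]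
    (T : ℝ) (f f' : ℝ → X) : Prop where
  locallyIntegrable : LocallyIntegrableOn f (Ioo 0 T)
  locallyIntegrable_deriv : LocallyIntegrableOn f' (Ioo 0 T)
  integral_eq : ∀ η : ℝ → ℝ, IsTestFunction (Ioo 0 T) η →
    ∫ t in Ioo 0 T, deriv η t • f t = -∫ t in Ioo 0 T, η t • f' t

/-- `f ∈ Lᵖ((0,T), X)`. -/
abbrev MemLpTime {X : Type*} [NormedAddCommGroup X] (p : ℝ≥0∞) (T : ℝ) (f : ℝ → X) : Prop :=
  MemLp f p (volume.restrict (Ioo 0 T))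

/-- The coefficient matrix: entries in `L^∞(Ω)`, symmetric, uniformly elliptic. -/
structure IsAdmissibleMatrix {d : ℕ} (Ω : Set (Space d))
    (k : Space d → Matrix (Fin d) (Fin d) ℝ) : Prop where
  memLp : ∀ i j, MemLp (fun x => k x i j) ∞ (volume.restrict Ω)
  symm : ∀ᵐ x ∂(volume.restrict Ω), (k x).IsSymm
  elliptic : ∃ k₀ : ℝ, 0 < k₀ ∧ ∀ᵐ x ∂(volume.restrict Ω), ∀ ξ : Space d,
    k₀ * ‖ξ‖ ^ 2 ≤ ∑ i, ∑ j, k x i j * ξ i * ξ j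

/-- The bilinear form `𝓛(v, φ) = (k ∇v, ∇φ) + a (v, φ)` on `H¹₀(Ω)`. -/
def formL {d : ℕ} {Ω : Set (Space d)} (k : Space d → Matrix (Fin d) (Fin d) ℝ) (a : ℝ)
    (v φ : H10 Ω) : ℝ :=
  (∫ x in Ω, ∑ i, ∑ j, k x i j * H10.grad v x j * H10.grad φ x i)
    + a * ⟪H10.val v, H10.val φ⟫_ℝ

/-- `u : [0,T] → L²(Ω)` is a weak solution of the single-phase-lag problem. In the witnesses, `w`
is `u` as an element of `L^∞((0,T), H¹₀(Ω))`, `ut` is `∂ₜu`, and `z` is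
`∂ₜ(g_α ∗ (∂ₜu - V₀))`. -/
def IsWeakSolution {d : ℕ} (Ω : Set (Space d)) (T α ρ c τq a : ℝ)
    (k : Space d → Matrix (Fin d) (Fin d) ℝ) (F : ℝ → L2 Ω) (U₀ V₀ : L2 Ω)
    (u : ℝ → L2 Ω) : Prop :=
  ContinuousOn u (Icc 0 T) ∧ u 0 = U₀ ∧
  ∃ (w : ℝ → H10 Ω) (ut : ℝ → L2 Ω) (z : ℝ → Hneg1 Ω),
    MemLpTime ∞ T w ∧ (∀ᵐ t ∂(volume.restrict (Ioo 0 T)), H10.val (w t) = u t) ∧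
    MemLpTime 2 T ut ∧ IsWeakTimeDeriv T u ut ∧
    MemLpTime 2 T z ∧
    IsWeakTimeDeriv T
      (fun t => L2.toDual (laplaceConv (rlKernel α) (fun s => ut s - V₀) t)) z ∧
    ∀ᵐ t ∂(volume.restrict (Ioo 0 T)), ∀ φ : H10 Ω,
      ρ * c * τq ^ α * z t φ
        + a * τq ^ α * ⟪laplaceConv (rlKernel α) ut t, H10.val φ⟫_ℝ
        + ρ * c * ⟪ut t, H10.val φ⟫_ℝ
        + formL k a (w t) φ
        = ⟪F t, H10.val φ⟫_ℝ

end SPL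

end

/-!
Let `u = u₁ - u₂`, `y = g_α * ∂ₜu`, and write `A = ρcτ_q^α`, `C = ρc`, `β = a/(ρc)`. Since
`aτ_q^α = βA` and `a = βC`, the difference of the two equations is
`Q' + βQ + (k∇u, ∇·) = 0` in `H⁻¹(Ω)` with `Q = A y + C u`, that is,
`(e^{βt} Q)' = -e^{βt} (k∇u, ∇·)`.

As `∂ₜu` is essentially bounded, `y(t) → 0` for `t → 0`, and `u(0) = 0`. Hence the equation can be
integrated in time: `e^{βt} Q(t) = -(k∇W(t), ∇·)` with `W(t) = ∫₀ᵗ e^{βs} u(s) ds`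
(`IsWeakTimeDeriv.ae_eq_primitive`, a form of the du Bois-Reymond lemma). Unlike `∂ₜu`, the function
`e^{βt} u(t) = W'(t)` is admissible as a test function in `H¹₀(Ω)`; multiplying by `e^{-2βt}` and
integrating over `(0,T)` yields
`A ∫ (y, u) + C ∫ ‖u‖² + ∫ e^{-2βt} (k∇W, ∇W') = 0`.

The last integral is nonnegative because `(k∇W, ∇W')` is half the derivative of a nonnegative
function vanishing at `0` and the weight is decreasing (`integral_exp_neg_mul_nonneg`). The first
one is nonnegative because `g_α` is a positive superposition of exponentials `e^{-rt}`, and for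
these, with `q = e^{-r·} * ∂ₜu`, one has `u = q + r ∫ q` and so
`∫ (q, u) = ∫ ‖q‖² + (r/2) ‖∫ q‖² ≥ 0` (`integral_inner_rlKernel_nonneg`). Thus `∫ ‖u‖² = 0`.

The functions of time here are merely primitives of integrable functions; the integrations by parts
they require are instances of one Fubini argument (`integral_bilin_primitive_add`).
-/

namespace SPL

/-! ### Integration by parts for primitives -/

section Primitive

variable {E F G : Type*} [NormedAddCommGroup E] [NormedSpace ℝ E] [CompleteSpace E]
  [NormedAddCommGroup F] [NormedSpace ℝ F] [CompleteSpace F]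
  [NormedAddCommGroup G] [NormedSpace ℝ G] [CompleteSpace G]

/-- Lebesgue measure on the triangle `0 < s < t < T`, whose points are written `(t, s)`. -/
noncomputable def triangle (T : ℝ) : Measure (ℝ × ℝ) :=
  ((volume.restrict (Ioo 0 T)).prod (volume.restrict (Ioo 0 T))).restrict {p : ℝ × ℝ | p.2 < p.1}

instance (T : ℝ) : SFinite (triangle T) := by unfold triangle; infer_instance

omit [CompleteSpace G] in
lemma integral_triangle {T : ℝ} {f : ℝ × ℝ → G} (hf : Integrable f (triangle T)) :
    ∫ p, f p ∂(triangle T) = ∫ t in Ioo 0 T, ∫ s in Ioo 0 t, f (t, s) := by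
  have hS : MeasurableSet {p : ℝ × ℝ | p.2 < p.1} := measurableSet_lt measurable_snd measurable_fst
  rw [triangle, ← integral_indicator hS, integral_prod _ ((integrable_indicator_iff hS).2 hf)]
  refine setIntegral_congr_fun measurableSet_Ioo fun t ht => ?_
  have h : ∀ s, {p : ℝ × ℝ | p.2 < p.1}.indicator f (t, s)
      = (Iio t).indicator (fun s => f (t, s)) s :=
    fun s => by simp [indicator]
  simp only [h]
  rw [integral_indicator measurableSet_Iio, Measure.restrict_restrict measurableSet_Iio]
  congr 2
  ext s
  simp only [mem_inter_iff, mem_Iio, mem_Ioo]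
  constructor
  · rintro ⟨h1, h2, _⟩; exact ⟨h2, h1⟩
  · rintro ⟨h1, h2⟩; exact ⟨h2, h1, h2.trans ht.2⟩

/-- Integration by parts for a continuous bilinear map `B` and primitives of integrable functions:
both sides are the integral of `B (a t) (b s)` over the square, split along the diagonal. -/
lemma integral_bilin_primitive_add (B : E →L[ℝ] F →L[ℝ] G) {T : ℝ} {a : ℝ → E} {b : ℝ → F}
    (ha : IntegrableOn a (Ioo 0 T)) (hb : IntegrableOn b (Ioo 0 T)) :
    (∫ t in Ioo 0 T, B (a t) (∫ s in Ioo 0 t, b s))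
      + ∫ t in Ioo 0 T, B (∫ s in Ioo 0 t, a s) (b t)
      = B (∫ t in Ioo 0 T, a t) (∫ t in Ioo 0 T, b t) := by
  set μ := volume.restrict (Ioo (0 : ℝ) T) with hμ
  have hint : Integrable (fun z : ℝ × ℝ => B (a z.1) (b z.2)) (μ.prod μ) :=
    ha.op_fst_snd (by fun_prop) ⟨‖B‖, B.le_opNorm₂⟩ hb
  have hS : MeasurableSet {p : ℝ × ℝ | p.2 < p.1} := measurableSet_lt measurable_snd measurable_fst
  have hS' : MeasurableSet {p : ℝ × ℝ | p.1 < p.2} := measurableSet_lt measurable_fst measurable_snd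
  have hsub : ∀ t ∈ Ioo 0 T, Ioo 0 t ⊆ Ioo 0 T := fun t ht => Ioo_subset_Ioo_right ht.2.le
  rw [← integral_prod_bilin B ha hb, ← integral_add_compl hS hint]
  congr 1
  · refine Eq.symm ((integral_triangle (T := T) hint.restrict).trans ?_)
    refine setIntegral_congr_fun measurableSet_Ioo fun t ht => ?_
    exact ((B (a t)).integral_comp_comm (hb.mono_set (hsub t ht)))
  · -- The diagonal is a null set.
    have hdiag : ({p : ℝ × ℝ | p.2 < p.1}ᶜ : Set (ℝ × ℝ)) =ᵐ[μ.prod μ] {p : ℝ × ℝ | p.1 < p.2} := by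
      have h0 : ∀ᵐ p ∂(μ.prod μ), p.1 ≠ p.2 := by
        have hm : MeasurableSet {p : ℝ × ℝ | p.1 ≠ p.2} :=
          (measurableSet_eq_fun measurable_fst measurable_snd).compl
        rw [Measure.ae_prod_iff_ae_ae hm]
        refine Filter.Eventually.of_forall fun t => ?_
        have := (Measure.ae_ne (volume.restrict (Ioo (0 : ℝ) T)) t)
        filter_upwards [this] with s hs using hs.symm
      filter_upwards [h0] with p hp
      have : (p ∈ ({p : ℝ × ℝ | p.2 < p.1}ᶜ : Set (ℝ × ℝ))) = (p ∈ {p : ℝ × ℝ | p.1 < p.2}) := by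
        simp only [mem_compl_iff, mem_ofPred_eq, not_lt, eq_iff_iff]
        exact ⟨fun h => lt_of_le_of_ne h hp, le_of_lt⟩
      exact this
    rw [setIntegral_congr_set hdiag]
    have hsw := integral_triangle (T := T) (f := fun p => B (a p.2) (b p.1)) hint.swap.restrict
    have h2 : ∫ p in {p : ℝ × ℝ | p.1 < p.2}, B (a p.1) (b p.2) ∂(μ.prod μ)
        = ∫ p in {p : ℝ × ℝ | p.2 < p.1}, B (a p.2) (b p.1) ∂(μ.prod μ) := by
      rw [← integral_indicator hS, ← integral_indicator hS', ← integral_prod_swap]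
      rfl
    refine Eq.symm ((h2.trans hsw).trans ?_)
    refine setIntegral_congr_fun measurableSet_Ioo fun t ht => ?_
    exact ((B.flip (b t)).integral_comp_comm (ha.mono_set (hsub t ht)))

omit [CompleteSpace E] in
lemma setIntegral_Ioo_eq_intervalIntegral {f : ℝ → E} {t : ℝ} (ht : 0 ≤ t) :
    ∫ s in Ioo 0 t, f s = ∫ s in (0 : ℝ)..t, f s := by
  rw [intervalIntegral.integral_of_le ht, integral_Ioc_eq_integral_Ioo]

omit [CompleteSpace E] in
lemma continuousOn_primitive_Ioo {T : ℝ} {f : ℝ → E} (hf : IntegrableOn f (Ioo 0 T)) :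
    ContinuousOn (fun t => ∫ s in Ioo 0 t, f s) (Icc 0 T) := by
  have h : IntegrableOn f (Icc 0 T) := by rwa [integrableOn_Icc_iff_integrableOn_Ioo]
  refine (intervalIntegral.continuousOn_primitive h).congr fun t ht => ?_
  exact (integral_Ioc_eq_integral_Ioo).symm

end Primitive

/-! ### Weak time derivatives -/

section WeakDeriv

variable {X Y : Type*} [NormedAddCommGroup X] [NormedSpace ℝ X]
  [NormedAddCommGroup Y] [NormedSpace ℝ Y]

lemma IsTestFunction.integrable_smul {U : Set ℝ} {η : ℝ → ℝ} (hη : IsTestFunction U η)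
    {f : ℝ → X} (hf : LocallyIntegrableOn f U) : Integrable (fun t => η t • f t) := by
  have hK : IsCompact (tsupport η) := hη.hasCompactSupport
  have h : (tsupport η).indicator (fun x ↦ η x • f x) = fun x ↦ η x • f x := by
    refine indicator_eq_self.2 (Function.support_subset_iff'.2 fun x hx => ?_)
    simp [image_eq_zero_of_notMem_tsupport hx]
  rw [← h, indicator_smul]
  refine Integrable.smul_of_top_right ?_
    (hη.contDiff.continuous.memLp_top_of_hasCompactSupport hK volume)
  rw [integrable_indicator_iff hK.measurableSet]
  exact hf.integrableOn_compact_subset hη.tsupport_subset hK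

lemma IsTestFunction.setIntegral_smul {U : Set ℝ} {η : ℝ → ℝ} (hη : IsTestFunction U η)
    (f : ℝ → X) : ∫ t in U, η t • f t = ∫ t, η t • f t := by
  refine setIntegral_eq_integral_of_forall_compl_eq_zero fun t ht => ?_
  rw [image_eq_zero_of_notMem_tsupport fun h => ht (hη.tsupport_subset h), zero_smul]

lemma IsTestFunction.deriv_isTestFunction {U : Set ℝ} {η : ℝ → ℝ} (hη : IsTestFunction U η) :
    IsTestFunction U (deriv η) :=
  ⟨(contDiff_infty_iff_deriv.1 hη.contDiff).2, hη.hasCompactSupport.deriv,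
    tsupport_deriv_subset.trans hη.tsupport_subset⟩

lemma IsTestFunction.mul_left {U : Set ℝ} {η χ : ℝ → ℝ} (hη : IsTestFunction U η)
    (hχ : ContDiff ℝ ∞ χ) : IsTestFunction U (fun t => χ t * η t) :=
  ⟨hχ.mul hη.contDiff, hη.hasCompactSupport.mul_left,
    (closure_mono (Function.support_mul_subset_right χ η)).trans hη.tsupport_subset⟩

namespace IsWeakTimeDeriv

variable {T : ℝ} {f f' g g' : ℝ → X}

lemma add (hf : IsWeakTimeDeriv T f f') (hg : IsWeakTimeDeriv T g g') :
    IsWeakTimeDeriv T (fun t => f t + g t) (fun t => f' t + g' t) := by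
  refine ⟨hf.1.add hg.1, hf.2.add hg.2, fun η hη => ?_⟩
  simp only [smul_add]
  rw [integral_add (hη.deriv_isTestFunction.integrable_smul hf.1).integrableOn
      (hη.deriv_isTestFunction.integrable_smul hg.1).integrableOn,
    integral_add (hη.integrable_smul hf.2).integrableOn (hη.integrable_smul hg.2).integrableOn,
    hf.3 η hη, hg.3 η hη, neg_add]

lemma clm_comp (L : X →L[ℝ] Y) [CompleteSpace X] [CompleteSpace Y] (hf : IsWeakTimeDeriv T f f') :
    IsWeakTimeDeriv T (fun t => L (f t)) (fun t => L (f' t)) := by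
  refine ⟨L.locallyIntegrableOn_comp hf.1, L.locallyIntegrableOn_comp hf.2, fun η hη => ?_⟩
  simp only [← map_smul]
  rw [L.integral_comp_comm (hη.deriv_isTestFunction.integrable_smul hf.1).integrableOn,
    L.integral_comp_comm (hη.integrable_smul hf.2).integrableOn, hf.3 η hη, map_neg]

lemma const_smul (hf : IsWeakTimeDeriv T f f') (r : ℝ) :
    IsWeakTimeDeriv T (fun t => r • f t) (fun t => r • f' t) := by
  refine ⟨hf.1.smul r, hf.2.smul r, fun η hη => ?_⟩
  simp only [smul_comm _ r]
  rw [integral_smul, integral_smul, hf.3 η hη, smul_neg]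

lemma sub (hf : IsWeakTimeDeriv T f f') (hg : IsWeakTimeDeriv T g g') :
    IsWeakTimeDeriv T (fun t => f t - g t) (fun t => f' t - g' t) := by
  simpa [sub_eq_add_neg] using hf.add (hg.const_smul (-1))

lemma congr (hf : IsWeakTimeDeriv T f f') (hfg : ∀ᵐ t ∂(volume.restrict (Ioo 0 T)), f t = g t)
    (hfg' : ∀ᵐ t ∂(volume.restrict (Ioo 0 T)), f' t = g' t) : IsWeakTimeDeriv T g g' := by
  refine ⟨hf.1.congr hfg, hf.2.congr hfg', fun η hη => ?_⟩
  rw [← integral_congr_ae (hfg.mono fun t ht => congrArg (deriv η t • ·) ht),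
    ← integral_congr_ae (hfg'.mono fun t ht => congrArg (η t • ·) ht), hf.3 η hη]

/-- The product rule with a smooth scalar factor `χ`, obtained by testing with `χ η`. -/
lemma smooth_smul (hf : IsWeakTimeDeriv T f f') {χ : ℝ → ℝ} (hχ : ContDiff ℝ ∞ χ) :
    IsWeakTimeDeriv T (fun t => χ t • f t) (fun t => deriv χ t • f t + χ t • f' t) := by
  have hloc : ∀ {h : ℝ → X} {χ : ℝ → ℝ}, ContDiff ℝ ∞ χ → LocallyIntegrableOn h (Ioo 0 T) →
      LocallyIntegrableOn (fun t => χ t • h t) (Ioo 0 T) := fun hχ hh =>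
    hh.continuousOn_smul isOpen_Ioo.isLocallyClosed hχ.continuous.continuousOn
  have hχ' : ContDiff ℝ ∞ (deriv χ) := (contDiff_infty_iff_deriv.1 hχ).2
  refine ⟨hloc hχ hf.1, (hloc hχ' hf.1).add (hloc hχ hf.2), fun η hη => ?_⟩
  have h := hf.3 _ (hη.mul_left hχ)
  have hd : ∀ t, deriv (fun t => χ t * η t) t = deriv χ t * η t + χ t * deriv η t := fun t =>
    deriv_fun_mul (hχ.differentiable (by simp) t) (hη.contDiff.differentiable (by simp) t)
  simp only [hd, add_smul] at h
  have i1 := (hη.integrable_smul (hloc hχ' hf.1)).integrableOn (s := Ioo 0 T)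
  have i2 := (hη.deriv_isTestFunction.integrable_smul (hloc hχ hf.1)).integrableOn (s := Ioo 0 T)
  have i3 := (hη.integrable_smul (hloc hχ hf.2)).integrableOn (s := Ioo 0 T)
  simp only [smul_smul] at i1 i2 i3
  simp only [smul_add, smul_smul]
  rw [integral_add i1 i3]
  simp only [mul_comm (deriv χ _), mul_comm (χ _)] at h i2 ⊢
  rw [integral_add i1 i2] at h
  rw [neg_add, ← h]
  abel

end IsWeakTimeDeriv

lemma exists_Icc_subset_Ioo {T : ℝ} (hT : 0 < T) {K : Set ℝ} (hK : IsCompact K)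
    (hKT : K ⊆ Ioo 0 T) : ∃ a b, 0 < a ∧ a ≤ b ∧ b < T ∧ K ⊆ Icc a b := by
  rcases K.eq_empty_or_nonempty with rfl | hne
  · exact ⟨T / 2, T / 2, by linarith, le_rfl, by linarith, empty_subset _⟩
  · obtain ⟨a, ha, ha'⟩ := hK.exists_isLeast hne
    obtain ⟨b, hb, hb'⟩ := hK.exists_isGreatest hne
    exact ⟨a, b, (hKT ha).1, ha' hb, (hKT hb).2, fun x hx => ⟨ha' hx, hb' hx⟩⟩

/-- A test function on `(0,T)` with zero mean has a primitive which is a test function. -/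
lemma IsTestFunction.exists_primitive {T : ℝ} (hT : 0 < T) {ψ : ℝ → ℝ}
    (hψ : IsTestFunction (Ioo 0 T) ψ) (h0 : ∫ t in Ioo 0 T, ψ t = 0) :
    ∃ η, IsTestFunction (Ioo 0 T) η ∧ deriv η = ψ := by
  obtain ⟨a, b, ha, hab, hb, hsub⟩ := exists_Icc_subset_Ioo hT hψ.hasCompactSupport
    hψ.tsupport_subset
  have hz : ∀ t, t ∉ Icc a b → ψ t = 0 := fun t ht =>
    image_eq_zero_of_notMem_tsupport fun h => ht (hsub h)
  have hc := hψ.contDiff.continuous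
  have hd : ∀ t, HasDerivAt (fun t => ∫ s in (0 : ℝ)..t, ψ s) (ψ t) t := fun t =>
    intervalIntegral.integral_hasDerivAt_right (hc.intervalIntegrable _ _)
      hc.aestronglyMeasurable.stronglyMeasurableAtFilter hc.continuousAt
  have hderiv : deriv (fun t => ∫ s in (0 : ℝ)..t, ψ s) = ψ := funext fun t => (hd t).deriv
  rw [setIntegral_Ioo_eq_intervalIntegral hT.le] at h0
  -- The primitive vanishes left of the support of `ψ`, and, by the zero mean, right of it.
  have hsupp : tsupport (fun t => ∫ s in (0 : ℝ)..t, ψ s) ⊆ Icc a b := by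
    refine closure_minimal (Function.support_subset_iff'.2 fun t ht => ?_) isClosed_Icc
    rcases lt_or_ge t a with h | h
    · refine intervalIntegral.integral_zero_ae (Filter.Eventually.of_forall fun s hs => hz s ?_)
      intro hs'
      have := hs.2
      rcases le_max_iff.1 this with h' | h' <;> linarith [hs'.1]
    · have hbt : b < t := by
        by_contra! h'
        exact ht ⟨h, h'⟩
      rw [← intervalIntegral.integral_add_adjacent_intervals (hc.intervalIntegrable 0 T)
        (hc.intervalIntegrable T t), h0, zero_add]
      refine intervalIntegral.integral_zero_ae (Filter.Eventually.of_forall fun s hs => hz s ?_)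
      intro hs'
      have := hs.1
      rcases min_lt_iff.1 this with h' | h' <;> linarith [hs'.2]
  refine ⟨_, ⟨contDiff_infty_iff_deriv.2 ⟨fun t => (hd t).differentiableAt, ?_⟩,
    isCompact_Icc.of_isClosed_subset (isClosed_tsupport _) hsupp,
    hsupp.trans (Icc_subset_Ioo ha hb)⟩, hderiv⟩
  rw [hderiv]
  exact hψ.contDiff

lemma IsWeakTimeDeriv.ae_unique [CompleteSpace X] {T : ℝ} {f f' f'' : ℝ → X}
    (h' : IsWeakTimeDeriv T f f') (h'' : IsWeakTimeDeriv T f f'') :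
    ∀ᵐ t ∂(volume.restrict (Ioo 0 T)), f' t = f'' t := by
  rw [ae_restrict_iff' measurableSet_Ioo]
  have key := isOpen_Ioo.ae_eq_zero_of_integral_contDiff_smul_eq_zero (U := Ioo 0 T)
    (f := fun t => f' t - f'' t) (μ := volume) (h'.2.sub h''.2) ?_
  · filter_upwards [key] with t ht hmem using sub_eq_zero.1 (ht hmem)
  intro η h1 h2 h3
  have hη : IsTestFunction (Ioo 0 T) η := ⟨h1, h2, h3⟩
  rw [← hη.setIntegral_smul]
  simp only [smul_sub]
  rw [integral_sub (hη.integrable_smul h'.2).integrableOn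
    (hη.integrable_smul h''.2).integrableOn, sub_eq_zero, ← neg_inj, ← h'.3 η hη, ← h''.3 η hη]

/-- The du Bois-Reymond lemma: a function with vanishing weak derivative is constant. -/
lemma IsWeakTimeDeriv.exists_ae_eq_const [CompleteSpace X] {T : ℝ} (hT : 0 < T) {f : ℝ → X}
    (hf : IsWeakTimeDeriv T f 0) : ∃ x, ∀ᵐ t ∂(volume.restrict (Ioo 0 T)), f t = x := by
  -- A bump `θ` of mass `I ≠ 0`; the constant is the `θ`-weighted mean `x` of `f`.
  let θ : ContDiffBump (T / 2) := ⟨T / 8, T / 4, by linarith, by linarith⟩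
  have hθ : IsTestFunction (Ioo 0 T) θ := by
    refine ⟨θ.contDiff, θ.hasCompactSupport, ?_⟩
    rw [θ.tsupport_eq, Real.closedBall_eq_Icc]
    exact Icc_subset_Ioo (by simp only [θ]; linarith) (by simp only [θ]; linarith)
  have hI : 0 < ∫ t in Ioo 0 T, θ t := by
    have := hθ.setIntegral_smul (fun _ => (1 : ℝ))
    simp only [smul_eq_mul, mul_one] at this
    rw [this]
    exact θ.integral_pos
  set I := ∫ t in Ioo 0 T, θ t with hIdef
  set x := I⁻¹ • ∫ t in Ioo 0 T, θ t • f t with hx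
  refine ⟨x, ?_⟩
  rw [ae_restrict_iff' measurableSet_Ioo]
  have key := isOpen_Ioo.ae_eq_zero_of_integral_contDiff_smul_eq_zero (U := Ioo 0 T)
    (f := fun t => f t - x) (μ := volume) (hf.1.sub (locallyIntegrableOn_const x)) ?_
  · filter_upwards [key] with t ht hmem using sub_eq_zero.1 (ht hmem)
  intro ψ h1 h2 h3
  have hψ : IsTestFunction (Ioo 0 T) ψ := ⟨h1, h2, h3⟩
  -- `ψ - c θ` has zero mean, so it is the derivative of a test function.
  set c := I⁻¹ * ∫ t in Ioo 0 T, ψ t with hc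
  have hint : ∀ {χ : ℝ → ℝ}, IsTestFunction (Ioo 0 T) χ → IntegrableOn χ (Ioo 0 T) := fun hχ =>
    (hχ.contDiff.continuous.integrable_of_hasCompactSupport hχ.hasCompactSupport).integrableOn
  have hcθ : IsTestFunction (Ioo 0 T) (fun t => -c * θ t) := hθ.mul_left contDiff_const
  have hdiff : IsTestFunction (Ioo 0 T) (ψ + fun t => -c * θ t) :=
    ⟨hψ.1.add hcθ.1, hψ.2.add hcθ.2,
      (tsupport_add _ _).trans (union_subset hψ.tsupport_subset hcθ.tsupport_subset)⟩
  obtain ⟨η, hη, hηd⟩ := hdiff.exists_primitive hT (by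
    simp only [Pi.add_apply]
    rw [integral_add (hint hψ) (hint hcθ), integral_const_mul, hc]
    rw [← hIdef]
    field_simp
    ring)
  have h := hf.3 η hη
  rw [hηd] at h
  simp only [Pi.add_apply, Pi.zero_apply, smul_zero, integral_zero, neg_zero, add_smul] at h
  rw [integral_add (hψ.integrable_smul hf.1).integrableOn
    (hcθ.integrable_smul hf.1).integrableOn] at h
  simp only [mul_smul] at h
  rw [integral_smul] at h
  rw [← hψ.setIntegral_smul]
  simp only [smul_sub]
  rw [integral_sub (hψ.integrable_smul hf.1).integrableOn
    (hψ.integrable_smul (locallyIntegrableOn_const x)).integrableOn, integral_smul_const, hx]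
  rw [hc] at h
  rw [← h, smul_smul, mul_comm I⁻¹]
  simp [sub_eq_add_neg]

/-- A function with an integrable weak derivative is a.e. a primitive of it. -/
lemma IsWeakTimeDeriv.exists_ae_eq_primitive [CompleteSpace X] {T : ℝ} (hT : 0 < T)
    {f f' : ℝ → X} (hf : IsWeakTimeDeriv T f f') (hf' : IntegrableOn f' (Ioo 0 T)) :
    ∃ x, ∀ᵐ t ∂(volume.restrict (Ioo 0 T)), f t = x + ∫ s in Ioo 0 t, f' s := by
  have hP : IsWeakTimeDeriv T (fun t => ∫ s in Ioo 0 t, f' s) f' := by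
    refine ⟨((continuousOn_primitive_Ioo hf').mono Ioo_subset_Icc_self).locallyIntegrableOn
      measurableSet_Ioo, hf.2, fun η hη => ?_⟩
    have hηd : IntegrableOn (deriv η) (Ioo 0 T) :=
      (hη.deriv_isTestFunction.contDiff.continuous.integrable_of_hasCompactSupport
        hη.deriv_isTestFunction.hasCompactSupport).integrableOn
    have hη0 : η 0 = 0 := image_eq_zero_of_notMem_tsupport fun h => (hη.tsupport_subset h).1.ne rfl
    have hηT : η T = 0 := image_eq_zero_of_notMem_tsupport fun h => (hη.tsupport_subset h).2.ne rfl
    have hprim : ∀ t, 0 ≤ t → ∫ s in Ioo 0 t, deriv η s = η t := fun t ht => by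
      rw [setIntegral_Ioo_eq_intervalIntegral ht, intervalIntegral.integral_deriv_eq_sub
        (fun s _ => hη.contDiff.differentiable (by simp) s)
        (hη.deriv_isTestFunction.contDiff.continuous.intervalIntegrable _ _), hη0, sub_zero]
    have h := integral_bilin_primitive_add (ContinuousLinearMap.lsmul ℝ ℝ : ℝ →L[ℝ] X →L[ℝ] X)
      hηd hf'
    simp only [ContinuousLinearMap.lsmul_apply] at h
    rw [hprim T hT.le, hηT, zero_smul, setIntegral_congr_fun (g := fun t => η t • f' t)
      (f := fun t => (∫ s in Ioo 0 t, deriv η s) • f' t)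
      measurableSet_Ioo (fun t ht => by simp only [hprim t ht.1.le])] at h
    exact eq_neg_of_add_eq_zero_left h
  have h0 : IsWeakTimeDeriv T (fun t => f t - ∫ s in Ioo 0 t, f' s) 0 :=
    (hf.sub hP).congr (Filter.Eventually.of_forall fun _ => rfl)
      (Filter.Eventually.of_forall fun _ => sub_self _)
  obtain ⟨x, hx⟩ := h0.exists_ae_eq_const hT
  exact ⟨x, hx.mono fun t ht => by rw [← ht, sub_add_cancel]⟩

/-- The constant of integration vanishes as soon as `‖f t‖` is a.e. bounded by some `N t` tending
to `0` as `t → 0⁺`. -/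
lemma IsWeakTimeDeriv.ae_eq_primitive [CompleteSpace X] {T : ℝ} (hT : 0 < T)
    {f f' : ℝ → X} (hf : IsWeakTimeDeriv T f f') (hf' : IntegrableOn f' (Ioo 0 T))
    {N : ℝ → ℝ} (hN : Filter.Tendsto N (nhdsWithin 0 (Ioi 0)) (nhds 0))
    (hfN : ∀ᵐ t ∂(volume.restrict (Ioo 0 T)), ‖f t‖ ≤ N t) :
    ∀ᵐ t ∂(volume.restrict (Ioo 0 T)), f t = ∫ s in Ioo 0 t, f' s := by
  obtain ⟨x, hx⟩ := hf.exists_ae_eq_primitive hT hf'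
  suffices x = 0 by simpa [this] using hx
  have hP : Filter.Tendsto (fun t => ∫ s in Ioo 0 t, f' s) (nhdsWithin 0 (Ioi 0)) (nhds 0) := by
    have h := (continuousOn_primitive_Ioo hf') 0 ⟨le_rfl, hT.le⟩
    have h2 : Filter.Tendsto (fun t => ∫ s in Ioo 0 t, f' s) (nhdsWithin 0 (Icc 0 T))
        (nhds (∫ s in Ioo (0 : ℝ) 0, f' s)) := h
    simp only [Ioo_self, Measure.restrict_empty, integral_zero_measure] at h2
    refine h2.mono_left ?_
    rw [← nhdsWithin_Ioo_eq_nhdsGT hT]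
    exact nhdsWithin_mono _ Ioo_subset_Icc_self
  -- The a.e. relations hold at points arbitrarily close to `0`, where they bound `‖x‖`.
  have hfreq : ∃ᶠ t in nhdsWithin (0 : ℝ) (Ioi 0), ‖x‖ ≤ N t + ‖∫ s in Ioo 0 t, f' s‖ := by
    rw [Filter.Frequently]
    intro hev
    rw [← nhdsWithin_Ioo_eq_nhdsGT hT] at hev
    obtain ⟨δ, hδ, hsub⟩ := (mem_nhdsGT_iff_exists_Ioo_subset' hT).1
      (by rw [← nhdsWithin_Ioo_eq_nhdsGT hT]; exact hev)
    have hδ : (0:ℝ) < δ := hδ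
    have hpos : 0 < min δ T := lt_min hδ hT
    have hae : ∀ᵐ t ∂(volume.restrict (Ioo 0 (min δ T))), False := by
      have hle : Ioo 0 (min δ T) ⊆ Ioo 0 T := Ioo_subset_Ioo_right (min_le_right _ _)
      filter_upwards [ae_restrict_of_ae_restrict_of_subset hle hx,
        ae_restrict_of_ae_restrict_of_subset hle hfN, ae_restrict_mem measurableSet_Ioo]
        with t h1 h2 h3
      refine hsub ⟨h3.1, h3.2.trans_le (min_le_left _ _)⟩ ?_
      have : x = f t - ∫ s in Ioo 0 t, f' s := by rw [h1]; abel
      rw [this]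
      exact (norm_sub_le _ _).trans (by gcongr)
    rw [Filter.eventually_false_iff_eq_bot, ae_eq_bot, Measure.restrict_eq_zero,
      Real.volume_Ioo] at hae
    simp at hae
    rcases hae with h | h <;> linarith
  have hlim : Filter.Tendsto (fun t => N t + ‖∫ s in Ioo 0 t, f' s‖)
      (nhdsWithin 0 (Ioi 0)) (nhds 0) := by
    simpa using hN.add hP.norm
  have := ge_of_tendsto_of_frequently hlim hfreq
  exact norm_le_zero_iff.1 this

end WeakDeriv

/-! ### Positivity of the Riemann–Liouville kernel -/

section Kernel

variable {H : Type*} [NormedAddCommGroup H] [InnerProductSpace ℝ H] [CompleteSpace H]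

lemma setIntegral_exp_neg {r t : ℝ} (ht : 0 ≤ t) :
    ∫ s in Ioo 0 t, -r * Real.exp (-(r * s)) = Real.exp (-(r * t)) - 1 := by
  rw [setIntegral_Ioo_eq_intervalIntegral ht,
    intervalIntegral.integral_eq_sub_of_hasDerivAt (f := fun s => Real.exp (-(r * s)))]
  · simp
  · intro s _
    have := (((hasDerivAt_id s).const_mul r).neg).exp
    simpa [mul_comm] using this
  · exact Continuous.intervalIntegrable (by fun_prop) _ _

/-- With `q = e^{-r·} * v` one has `∫₀ᵗ v = q(t) + r ∫₀ᵗ q`. -/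
lemma primitive_eq_expConv_add {r t : ℝ} (ht : 0 ≤ t) {v : ℝ → H} (hv : IntegrableOn v (Ioo 0 t)) :
    ∫ s in Ioo 0 t, v s = (∫ s in Ioo 0 t, Real.exp (-(r * (t - s))) • v s)
      + r • ∫ τ in Ioo 0 t, ∫ s in Ioo 0 τ, Real.exp (-(r * (τ - s))) • v s := by
  have hexp : ∀ τ, ∫ s in Ioo 0 τ, Real.exp (-(r * (τ - s))) • v s
      = Real.exp (-(r * τ)) • ∫ s in Ioo 0 τ, Real.exp (r * s) • v s := fun τ => by
    rw [← integral_smul]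
    congr 1 with s
    rw [smul_smul, ← Real.exp_add]
    congr 2
    ring
  simp only [hexp]
  have hb : IntegrableOn (fun s => Real.exp (r * s) • v s) (Ioo 0 t) := by
    rw [← integrableOn_Icc_iff_integrableOn_Ioo] at hv ⊢
    exact hv.continuousOn_smul (by fun_prop) isCompact_Icc
  have ha : IntegrableOn (fun s => -r * Real.exp (-(r * s))) (Ioo 0 t) :=
    (Continuous.integrableOn_Icc (by fun_prop)).mono_set Ioo_subset_Icc_self
  have hprim : ∀ τ, 0 ≤ τ → ∫ s in Ioo 0 τ, -r * Real.exp (-(r * s)) = Real.exp (-(r * τ)) - 1 :=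
    fun τ hτ => setIntegral_exp_neg hτ
  -- Integrate `e^{rs} v(s)` by parts against the derivative of `e^{-rs}`.
  have h := integral_bilin_primitive_add (ContinuousLinearMap.lsmul ℝ ℝ : ℝ →L[ℝ] H →L[ℝ] H) ha hb
  simp only [ContinuousLinearMap.lsmul_apply] at h
  rw [hprim t ht, setIntegral_congr_fun (f := fun τ => (∫ s in Ioo 0 τ, -r * Real.exp (-(r * s))) •
      Real.exp (r * τ) • v τ) (g := fun τ => v τ - Real.exp (r * τ) • v τ)
      measurableSet_Ioo (fun τ hτ => by
        simp only [hprim τ hτ.1.le]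
        rw [sub_smul, one_smul, smul_smul, ← Real.exp_add]
        simp), integral_sub hv hb] at h
  simp only [mul_smul] at h
  rw [integral_smul] at h
  rw [sub_smul, one_smul, neg_smul] at h
  rw [← sub_eq_zero] at h ⊢
  rw [← h]
  abel

/-- The exponential kernel is of positive type when tested against a primitive: for
`q = e^{-r·} * v` the integral is `∫ ‖q‖² + (r / 2) ‖∫ q‖²`. -/
lemma integral_inner_expConv_nonneg {r T : ℝ} (hr : 0 ≤ r) {v : ℝ → H}
    (hv : IntegrableOn v (Ioo 0 T)) :
    0 ≤ ∫ t in Ioo 0 T, ⟪∫ s in Ioo 0 t, Real.exp (-(r * (t - s))) • v s,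
      ∫ s in Ioo 0 t, v s⟫_ℝ := by
  set q : ℝ → H := fun t => ∫ s in Ioo 0 t, Real.exp (-(r * (t - s))) • v s with hq
  have hqc : ContinuousOn q (Icc 0 T) := by
    have hb : IntegrableOn (fun s => Real.exp (r * s) • v s) (Ioo 0 T) := by
      rw [← integrableOn_Icc_iff_integrableOn_Ioo] at hv ⊢
      exact hv.continuousOn_smul (by fun_prop) isCompact_Icc
    have : q = fun t => Real.exp (-(r * t)) • ∫ s in Ioo 0 t, Real.exp (r * s) • v s := by
      funext t
      rw [hq, ← integral_smul]
      refine integral_congr_ae (Filter.Eventually.of_forall fun s => ?_)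
      simp only [smul_smul, ← Real.exp_add]
      congr 2
      ring
    rw [this]
    exact ContinuousOn.smul (by fun_prop) (continuousOn_primitive_Ioo hb)
  have hqi : IntegrableOn q (Ioo 0 T) := hqc.integrableOn_Icc.mono_set Ioo_subset_Icc_self
  have hQc := continuousOn_primitive_Ioo hqi
  have heq : ∀ t ∈ Ioo 0 T, ⟪q t, ∫ s in Ioo 0 t, v s⟫_ℝ
      = ‖q t‖ ^ 2 + r * ⟪q t, ∫ s in Ioo 0 t, q s⟫_ℝ := fun t ht => by
    rw [primitive_eq_expConv_add (r := r) ht.1.le (hv.mono_set (Ioo_subset_Ioo_right ht.2.le)),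
      inner_add_right, inner_smul_right, real_inner_self_eq_norm_sq]
  rw [setIntegral_congr_fun measurableSet_Ioo heq, integral_add, integral_const_mul]
  · have h : (∫ t in Ioo 0 T, ⟪q t, ∫ s in Ioo 0 t, q s⟫_ℝ)
        + ∫ t in Ioo 0 T, ⟪∫ s in Ioo 0 t, q s, q t⟫_ℝ
        = ⟪∫ t in Ioo 0 T, q t, ∫ t in Ioo 0 T, q t⟫_ℝ :=
      integral_bilin_primitive_add (innerSL ℝ : H →L[ℝ] H →L[ℝ] ℝ) hqi hqi
    simp only [fun t => real_inner_comm (q t) (∫ s in Ioo 0 t, q s)] at h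
    have h2 : 0 ≤ ∫ t in Ioo 0 T, ⟪q t, ∫ s in Ioo 0 t, q s⟫_ℝ := by
      have := real_inner_self_nonneg (x := ∫ t in Ioo 0 T, q t)
      linarith
    have h1 : 0 ≤ ∫ t in Ioo 0 T, ‖q t‖ ^ 2 := integral_nonneg fun _ => by positivity
    positivity
  · exact (ContinuousOn.integrableOn_Icc (by fun_prop)).mono_set Ioo_subset_Icc_self
  · exact (ContinuousOn.integrableOn_Icc (by fun_prop)).mono_set Ioo_subset_Icc_self

/-- The Riemann–Liouville kernel is a positive superposition of exponentials. -/
lemma rlKernel_eq_integral_exp {α x : ℝ} (hα : α ∈ Ioo (0 : ℝ) 1) (hx : 0 < x) :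
    rlKernel α x = (Real.Gamma α * Real.Gamma (1 - α))⁻¹
      * ∫ r in Ioi 0, r ^ (α - 1) * Real.exp (-(r * x)) := by
  have h := Real.integral_rpow_mul_exp_neg_mul_Ioi hα.1 hx
  simp only [mul_comm x] at h
  have h1 := (Real.Gamma_pos_of_pos hα.1).ne'
  have h2 := (Real.Gamma_pos_of_pos (sub_pos.2 hα.2)).ne'
  rw [h, rlKernel, one_div, Real.inv_rpow hx.le, Real.rpow_neg hx.le]
  field_simp

lemma rlKernel_nonneg {α x : ℝ} (hα : α ∈ Ioo (0 : ℝ) 1) (hx : 0 ≤ x) : 0 ≤ rlKernel α x :=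
  div_nonneg (Real.rpow_nonneg hx _) (Real.Gamma_pos_of_pos (sub_pos.2 hα.2)).le

lemma integrableOn_rlKernel {α : ℝ} (hα : α ∈ Ioo (0 : ℝ) 1) (T : ℝ) :
    IntegrableOn (rlKernel α) (Ioo 0 T) := by
  rcases le_or_gt T 0 with h | h
  · simp [Ioo_eq_empty_of_le h]
  · have := (intervalIntegral.integrableOn_Ioo_rpow_iff (s := -α) h).2 (by linarith [hα.2])
    exact this.div_const _

omit [CompleteSpace H] in
lemma integrable_triangle_rlKernel_smul {α T : ℝ} (hα : α ∈ Ioo (0 : ℝ) 1) {v : ℝ → H}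
    (hv : IntegrableOn v (Ioo 0 T)) :
    Integrable (fun p : ℝ × ℝ => rlKernel α (p.1 - p.2) • v p.2) (triangle T) := by
  have h := Integrable.convolution_integrand (μ := volume) (ν := volume)
    (ContinuousLinearMap.lsmul ℝ ℝ : ℝ →L[ℝ] H →L[ℝ] H).flip
    ((integrable_indicator_iff measurableSet_Ioo).2 hv)
    ((integrable_indicator_iff measurableSet_Ioo).2 (integrableOn_rlKernel hα T))
  have hS : MeasurableSet {p : ℝ × ℝ | p.2 < p.1} := measurableSet_lt measurable_snd measurable_fst
  rw [triangle, Measure.prod_restrict, Measure.restrict_restrict hS]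
  refine h.restrict.congr ?_
  filter_upwards [ae_restrict_mem (hS.inter (measurableSet_Ioo.prod measurableSet_Ioo))] with p hp
  obtain ⟨h1, h2, h3⟩ := hp
  have h1 : p.2 < p.1 := h1
  have h4 : p.1 - p.2 ∈ Ioo 0 T := ⟨sub_pos.2 h1, by linarith [h2.2, h3.1]⟩
  simp [indicator_of_mem h4, indicator_of_mem h3]

omit [CompleteSpace H] in
lemma integrableOn_rlKernel_smul {α t : ℝ} (hα : α ∈ Ioo (0 : ℝ) 1) {v : ℝ → H} {M : ℝ}
    (hv : AEStronglyMeasurable v (volume.restrict (Ioo 0 t)))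
    (hM : ∀ᵐ s ∂(volume.restrict (Ioo 0 t)), ‖v s‖ ≤ M) :
    IntegrableOn (fun s => rlKernel α (t - s) • v s) (Ioo 0 t) := by
  refine (ContinuousLinearMap.lsmul ℝ ℝ : ℝ →L[ℝ] H →L[ℝ] H).integrable_of_bilin_of_bdd_right
    M ?_ hv hM
  rcases le_or_gt t 0 with h | h
  · simp [Ioo_eq_empty_of_le h]
  have := integrableOn_rlKernel hα t
  rw [← integrableOn_Ioc_iff_integrableOn_Ioo,
    ← intervalIntegrable_iff_integrableOn_Ioc_of_le h.le] at this
  have h2 := (this.comp_sub_left t).symm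
  rw [sub_self, sub_zero, intervalIntegrable_iff_integrableOn_Ioc_of_le h.le,
    integrableOn_Ioc_iff_integrableOn_Ioo] at h2
  exact h2

/-- The Riemann–Liouville kernel is of positive type when tested against a primitive, because it
is a positive superposition of exponentials. -/
lemma integral_inner_rlKernel_nonneg {α T : ℝ} (hα : α ∈ Ioo (0 : ℝ) 1) {v : ℝ → H}
    {M : ℝ} (hv : AEStronglyMeasurable v (volume.restrict (Ioo 0 T)))
    (hM : ∀ᵐ s ∂(volume.restrict (Ioo 0 T)), ‖v s‖ ≤ M) :
    0 ≤ ∫ t in Ioo 0 T, ⟪∫ s in Ioo 0 t, rlKernel α (t - s) • v s, ∫ s in Ioo 0 t, v s⟫_ℝ := by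
  have hvi : IntegrableOn v (Ioo 0 T) := Integrable.of_bound hv M hM
  set u : ℝ → H := fun t => ∫ s in Ioo 0 t, v s with hu
  have huc : ContinuousOn u (Icc 0 T) := continuousOn_primitive_Ioo hvi
  have hui : IntegrableOn u (Ioo 0 T) := huc.integrableOn_Icc.mono_set Ioo_subset_Icc_self
  obtain ⟨N, hN⟩ := isCompact_Icc.exists_bound_of_continuousOn huc
  have hS : MeasurableSet {p : ℝ × ℝ | p.2 < p.1} := measurableSet_lt measurable_snd measurable_fst
  have hmem : ∀ᵐ p ∂(triangle T), 0 < p.2 ∧ p.2 < p.1 ∧ p.1 < T := by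
    rw [triangle, Measure.prod_restrict, Measure.restrict_restrict hS]
    filter_upwards [ae_restrict_mem (hS.inter (measurableSet_Ioo.prod measurableSet_Ioo))] with p hp
    exact ⟨hp.2.2.1, hp.1, hp.2.1.2⟩
  have hsub : ∀ t ∈ Ioo 0 T, Ioo 0 t ⊆ Ioo 0 T := fun t ht => Ioo_subset_Ioo_right ht.2.le
  have hum : AEStronglyMeasurable (fun p : ℝ × ℝ => u p.1) (triangle T) :=
    (hui.aestronglyMeasurable.comp_fst (ν := volume.restrict (Ioo 0 T))).restrict
  have hvm : AEStronglyMeasurable (fun p : ℝ × ℝ => v p.2) (triangle T) :=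
    (hv.comp_snd (μ := volume.restrict (Ioo 0 T))).restrict
  -- The scalar integrand over the triangle.
  have hint : Integrable (fun p : ℝ × ℝ => ⟪rlKernel α (p.1 - p.2) • v p.2, u p.1⟫_ℝ)
      (triangle T) := by
    refine (innerSL ℝ : H →L[ℝ] H →L[ℝ] ℝ).integrable_of_bilin_of_bdd_right N
      (integrable_triangle_rlKernel_smul hα hvi) hum ?_
    filter_upwards [hmem] with p hp
    exact hN _ ⟨(hp.1.trans hp.2.1).le, hp.2.2.le⟩
  have h1 : ∫ t in Ioo 0 T, ⟪∫ s in Ioo 0 t, rlKernel α (t - s) • v s, u t⟫_ℝ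
      = ∫ p, ⟪rlKernel α (p.1 - p.2) • v p.2, u p.1⟫_ℝ ∂(triangle T) := by
    rw [integral_triangle hint]
    refine setIntegral_congr_fun measurableSet_Ioo fun t ht => ?_
    exact (((innerSL ℝ : H →L[ℝ] H →L[ℝ] ℝ).flip (u t)).integral_comp_comm
      (integrableOn_rlKernel_smul hα (hv.mono_measure (Measure.restrict_mono_set _ (hsub t ht)))
        (ae_restrict_of_ae_restrict_of_subset (hsub t ht) hM))).symm
  set c := (Real.Gamma α * Real.Gamma (1 - α))⁻¹ with hc
  have hcpos : 0 < c := inv_pos.2 (mul_pos (Real.Gamma_pos_of_pos hα.1)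
    (Real.Gamma_pos_of_pos (sub_pos.2 hα.2)))
  -- The integrand after inserting the exponential representation of the kernel.
  let K : ℝ × ℝ → ℝ → ℝ := fun p r =>
    r ^ (α - 1) * Real.exp (-(r * (p.1 - p.2))) * ⟪v p.2, u p.1⟫_ℝ
  have hKr : ∀ p : ℝ × ℝ, p.2 < p.1 →
      IntegrableOn (fun r => r ^ (α - 1) * Real.exp (-(r * (p.1 - p.2)))) (Ioi 0) := fun p hp => by
    have := integrableOn_rpow_mul_exp_neg_mul_rpow (s := α - 1) (p := 1) (b := p.1 - p.2)
      (by linarith [hα.1]) one_pos (sub_pos.2 hp)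
    refine IntegrableOn.congr_fun this (fun r _ => ?_) measurableSet_Ioi
    simp only [Real.rpow_one]
    congr 2
    ring
  have hrl : ∀ p : ℝ × ℝ, p.2 < p.1 →
      ∫ r in Ioi 0, K p r = c⁻¹ * ⟪rlKernel α (p.1 - p.2) • v p.2, u p.1⟫_ℝ := fun p hp => by
    simp only [K]
    rw [integral_mul_const, rlKernel_eq_integral_exp hα (sub_pos.2 hp), real_inner_smul_left,
      ← hc, mul_assoc c, ← mul_assoc c⁻¹, inv_mul_cancel₀ hcpos.ne', one_mul]
  have hKint : Integrable (Function.uncurry K) ((triangle T).prod (volume.restrict (Ioi 0))) := by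
    have hKm : AEStronglyMeasurable (Function.uncurry K)
        ((triangle T).prod (volume.restrict (Ioi 0))) := by
      refine AEStronglyMeasurable.mul ?_ (hvm.inner hum).comp_fst
      exact Measurable.aestronglyMeasurable (by fun_prop)
    rw [integrable_prod_iff hKm]
    constructor
    · filter_upwards [hmem] with p hp
      exact (hKr p hp.2.1).mul_const ⟪v p.2, u p.1⟫_ℝ
    · refine (hint.norm.const_mul c⁻¹).congr ?_
      filter_upwards [hmem] with p hp
      have h := hrl p hp.2.1
      rw [← Real.norm_of_nonneg (inv_pos.2 hcpos).le, ← norm_mul, ← h]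
      simp only [K, Function.uncurry]
      rw [integral_mul_const, norm_mul, Real.norm_of_nonneg
        (setIntegral_nonneg measurableSet_Ioi fun r hr => by have : (0:ℝ) < r := hr; positivity),
        ← integral_mul_const]
      refine setIntegral_congr_fun measurableSet_Ioi fun r hr => ?_
      have hr : (0:ℝ) < r := hr
      have hpos : 0 ≤ r ^ (α - 1) * Real.exp (-(r * (p.1 - p.2))) := by positivity
      rw [norm_mul (r ^ (α - 1) * Real.exp (-(r * (p.1 - p.2)))), Real.norm_of_nonneg hpos]
  have h2 : ∫ p, ⟪rlKernel α (p.1 - p.2) • v p.2, u p.1⟫_ℝ ∂(triangle T)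
      = c * ∫ r in Ioi 0, ∫ p, K p r ∂(triangle T) := by
    rw [← integral_integral_swap hKint, ← integral_const_mul]
    refine integral_congr_ae ?_
    filter_upwards [hmem] with p hp
    simp only [hrl p hp.2.1]
    field_simp
  rw [h1, h2]
  refine mul_nonneg hcpos.le (setIntegral_nonneg measurableSet_Ioi fun r hr => ?_)
  have hr : (0:ℝ) < r := hr
  have hexp : ∀ (k : ℝ) {f : ℝ → H}, IntegrableOn f (Ioo 0 T) →
      IntegrableOn (fun s => Real.exp (k * s) • f s) (Ioo 0 T) := fun k f hf => by
    rw [← integrableOn_Icc_iff_integrableOn_Ioo] at hf ⊢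
    exact hf.continuousOn_smul (by fun_prop) isCompact_Icc
  have hsplit : ∀ t s : ℝ, ⟪Real.exp (-(r * (t - s))) • v s, u t⟫_ℝ
      = ⟪Real.exp (r * s) • v s, Real.exp (-r * t) • u t⟫_ℝ := fun t s => by
    rw [real_inner_smul_left, real_inner_smul_left, real_inner_smul_right, ← mul_assoc,
      ← Real.exp_add]
    congr 2
    ring
  have hi : Integrable (fun p : ℝ × ℝ => ⟪Real.exp (-(r * (p.1 - p.2))) • v p.2, u p.1⟫_ℝ)
      (triangle T) := by
    simp only [hsplit]
    exact (Integrable.op_fst_snd (op := fun x y : H => ⟪y, x⟫_ℝ)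
      (by simp only [Function.uncurry_def]; fun_prop)
      ⟨1, fun x y => by simpa [mul_comm] using abs_real_inner_le_norm y x⟩
      (hexp (-r) hui) (hexp r hvi)).restrict
  have h3 : ∫ p, K p r ∂(triangle T) = r ^ (α - 1) * ∫ t in Ioo 0 T,
      ⟪∫ s in Ioo 0 t, Real.exp (-(r * (t - s))) • v s, u t⟫_ℝ := by
    have h4 : ∫ t in Ioo 0 T, ⟪∫ s in Ioo 0 t, Real.exp (-(r * (t - s))) • v s, u t⟫_ℝ
        = ∫ p, ⟪Real.exp (-(r * (p.1 - p.2))) • v p.2, u p.1⟫_ℝ ∂(triangle T) := by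
      rw [integral_triangle hi]
      refine setIntegral_congr_fun measurableSet_Ioo fun t ht => ?_
      refine (((innerSL ℝ : H →L[ℝ] H →L[ℝ] ℝ).flip (u t)).integral_comp_comm ?_).symm
      have := ((hexp r hvi).mono_set (hsub t ht)).smul (Real.exp (-r * t))
      refine IntegrableOn.congr_fun this (fun s _ => ?_) measurableSet_Ioo
      simp only [Pi.smul_apply, smul_smul, ← Real.exp_add]
      congr 2
      ring
    rw [h4, ← integral_const_mul]
    simp only [K, real_inner_smul_left, mul_assoc]
  rw [h3]
  exact mul_nonneg (Real.rpow_nonneg hr.le _) (integral_inner_expConv_nonneg hr.le hvi)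

omit [InnerProductSpace ℝ H] [CompleteSpace H] in
lemma MemLpTime.exists_bound {T : ℝ} {f : ℝ → H} (hf : MemLpTime ∞ T f) :
    ∃ M, ∀ᵐ t ∂(volume.restrict (Ioo 0 T)), ‖f t‖ ≤ M := by
  refine ⟨(eLpNorm f ∞ (volume.restrict (Ioo 0 T))).toReal, ?_⟩
  have h := ae_le_eLpNormEssSup (f := f) (μ := volume.restrict (Ioo 0 T))
  filter_upwards [h] with t ht
  rw [← toReal_enorm]
  exact ENNReal.toReal_mono hf.2.ne (by simpa [eLpNorm_exponent_top] using ht)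

omit [CompleteSpace H] in
lemma laplaceConv_eq {κ : ℝ → ℝ} {v : ℝ → H} {t : ℝ} (ht : 0 ≤ t) :
    laplaceConv κ v t = ∫ s in Ioo 0 t, κ (t - s) • v s :=
  (setIntegral_Ioo_eq_intervalIntegral ht).symm

omit [CompleteSpace H] in
lemma laplaceConv_rlKernel_sub {α T t : ℝ} (hα : α ∈ Ioo (0 : ℝ) 1) (ht : t ∈ Ioo 0 T)
    {v v' : ℝ → H} (hv : MemLpTime ∞ T v) (hv' : MemLpTime ∞ T v') :
    laplaceConv (rlKernel α) (fun s => v s - v' s) t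
      = laplaceConv (rlKernel α) v t - laplaceConv (rlKernel α) v' t := by
  have hsub : Ioo 0 t ⊆ Ioo 0 T := Ioo_subset_Ioo_right ht.2.le
  have hi : ∀ {v : ℝ → H}, MemLpTime ∞ T v →
      IntegrableOn (fun s => rlKernel α (t - s) • v s) (Ioo 0 t) := fun hv => by
    obtain ⟨M, hM⟩ := MemLpTime.exists_bound hv
    exact integrableOn_rlKernel_smul hα (hv.1.mono_measure (Measure.restrict_mono_set _ hsub))
      (ae_restrict_of_ae_restrict_of_subset hsub hM)
  simp only [laplaceConv_eq ht.1.le, smul_sub]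
  exact integral_sub (hi hv) (hi hv')

omit [CompleteSpace H] in
/-- The bound tends to `0` as `t → 0⁺`, the kernel being locally integrable. -/
lemma norm_laplaceConv_rlKernel_le {α T t M : ℝ} (hα : α ∈ Ioo (0 : ℝ) 1) (ht : t ∈ Ioo 0 T)
    {v : ℝ → H} (hM : ∀ᵐ s ∂(volume.restrict (Ioo 0 T)), ‖v s‖ ≤ M) :
    ‖laplaceConv (rlKernel α) v t‖ ≤ (∫ s in Ioo 0 t, rlKernel α s) * M := by
  have hrefl : ∫ s in Ioo 0 t, rlKernel α s = ∫ s in Ioo 0 t, rlKernel α (t - s) := by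
    rw [setIntegral_Ioo_eq_intervalIntegral ht.1.le, setIntegral_Ioo_eq_intervalIntegral ht.1.le,
      intervalIntegral.integral_comp_sub_left (rlKernel α) t]
    simp
  have hint : IntegrableOn (fun s => rlKernel α (t - s)) (Ioo 0 t) := by
    simpa using integrableOn_rlKernel_smul (H := ℝ) (v := fun _ => 1) (M := 1) (t := t) hα
      aestronglyMeasurable_const (by simp)
  rw [hrefl, laplaceConv_eq ht.1.le, ← integral_mul_const]
  refine norm_integral_le_of_norm_le (hint.mul_const M) ?_
  filter_upwards [ae_restrict_of_ae_restrict_of_subset (Ioo_subset_Ioo_right ht.2.le) hM,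
    ae_restrict_mem measurableSet_Ioo] with s hs hs'
  have := rlKernel_nonneg hα (sub_nonneg.2 hs'.2.le)
  rw [norm_smul, Real.norm_of_nonneg this]
  gcongr

end Kernel

/-! ### The energy argument in a Hilbert triple -/

section Abstract

variable {V H : Type*} [NormedAddCommGroup V] [NormedSpace ℝ V] [CompleteSpace V]
  [NormedAddCommGroup H] [InnerProductSpace ℝ H] [CompleteSpace H]

/-- A function with nonnegative primitives still has nonnegative integral after multiplication by a
decreasing exponential. -/
lemma integral_exp_neg_mul_nonneg {T κ : ℝ} (hT : 0 ≤ T) (hκ : 0 ≤ κ) {h : ℝ → ℝ}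
    (hh : IntegrableOn h (Ioo 0 T)) (hpos : ∀ t ∈ Icc 0 T, 0 ≤ ∫ s in Ioo 0 t, h s) :
    0 ≤ ∫ t in Ioo 0 T, Real.exp (-(κ * t)) * h t := by
  have ha : IntegrableOn (fun s => -κ * Real.exp (-(κ * s))) (Ioo 0 T) :=
    (Continuous.integrableOn_Icc (by fun_prop)).mono_set Ioo_subset_Icc_self
  have hprim : ∀ τ, 0 ≤ τ → ∫ s in Ioo 0 τ, -κ * Real.exp (-(κ * s)) = Real.exp (-(κ * τ)) - 1 :=
    fun τ hτ => setIntegral_exp_neg hτ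
  have hi : IntegrableOn (fun t => Real.exp (-(κ * t)) * h t) (Ioo 0 T) := by
    rw [← integrableOn_Icc_iff_integrableOn_Ioo] at hh ⊢
    exact hh.continuousOn_mul (by fun_prop) isCompact_Icc
  have hb := integral_bilin_primitive_add (ContinuousLinearMap.lsmul ℝ ℝ : ℝ →L[ℝ] ℝ →L[ℝ] ℝ) ha hh
  simp only [ContinuousLinearMap.lsmul_apply, smul_eq_mul] at hb
  rw [hprim T hT, setIntegral_congr_fun (f := fun τ => (∫ s in Ioo 0 τ, -κ * Real.exp (-(κ * s)))
      * h τ) (g := fun τ => Real.exp (-(κ * τ)) * h τ - h τ) measurableSet_Ioo (fun τ hτ => by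
        simp only [hprim τ hτ.1.le]
        ring), integral_sub hi hh] at hb
  have h1 : ∫ t in Ioo 0 T, -κ * Real.exp (-(κ * t)) * ∫ s in Ioo 0 t, h s ≤ 0 := by
    refine setIntegral_nonpos measurableSet_Ioo fun t ht => ?_
    have := mul_nonneg (mul_nonneg hκ (Real.exp_pos (-(κ * t))).le) (hpos t ⟨ht.1.le, ht.2.le⟩)
    linarith
  have h2 := mul_nonneg (Real.exp_pos (-(κ * T))).le (hpos T ⟨hT, le_rfl⟩)
  linarith

/-- The integral is half of the quadratic form at the primitive of `w`. -/
lemma integral_bilin_primitive_self_nonneg (b : V →L[ℝ] V →L[ℝ] ℝ) (hsymm : ∀ v w, b v w = b w v)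
    (hpos : ∀ v, 0 ≤ b v v) {T : ℝ} {w : ℝ → V} (hw : IntegrableOn w (Ioo 0 T)) :
    0 ≤ ∫ t in Ioo 0 T, b (∫ s in Ioo 0 t, w s) (w t) := by
  have h := integral_bilin_primitive_add b hw hw
  simp only [fun t => hsymm (w t) (∫ s in Ioo 0 t, w s)] at h
  linarith [hpos (∫ t in Ioo 0 T, w t)]

/-- Uniqueness in abstract form, for `A = ρcτ_q^α`, `C = ρc`, `β = a/(ρc)`. The coefficients
`βA` and `βC` of the zero order terms are what allows the factor `e^{βt}` to absorb them. -/
theorem eq_zero_of_energy (J : V →L[ℝ] H) (b : V →L[ℝ] V →L[ℝ] ℝ) (hsymm : ∀ v w, b v w = b w v)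
    (hpos : ∀ v, 0 ≤ b v v) {T α A C β : ℝ} (hT : 0 < T) (hα : α ∈ Ioo (0 : ℝ) 1) (hA : 0 ≤ A)
    (hC : 0 < C) (hβ : 0 ≤ β) {u ut : ℝ → H} {w : ℝ → V} {z : ℝ → V →L[ℝ] ℝ}
    (hu : ContinuousOn u (Icc 0 T)) (hu0 : u 0 = 0) (hw : MemLpTime ∞ T w)
    (hwu : ∀ᵐ t ∂(volume.restrict (Ioo 0 T)), J (w t) = u t)
    (hut : MemLpTime ∞ T ut) (hd : IsWeakTimeDeriv T u ut)
    (hz : IsWeakTimeDeriv T (fun t => (innerSL ℝ (laplaceConv (rlKernel α) ut t)).comp J) z)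
    (heq : ∀ᵐ t ∂(volume.restrict (Ioo 0 T)), ∀ φ : V,
      A * z t φ + β * A * ⟪laplaceConv (rlKernel α) ut t, J φ⟫_ℝ + C * ⟪ut t, J φ⟫_ℝ
        + β * C * ⟪u t, J φ⟫_ℝ + b (w t) φ = 0) :
    ∀ t ∈ Icc 0 T, u t = 0 := by
  obtain ⟨M, hM⟩ := MemLpTime.exists_bound hut
  set y := laplaceConv (rlKernel α) ut with hy
  -- The embedding of `H` into the dual of `V`.
  let D : H →L[ℝ] V →L[ℝ] ℝ :=
    ((ContinuousLinearMap.compL ℝ V H ℝ).flip J).comp (innerSL ℝ : H →L[ℝ] H →L[ℝ] ℝ)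
  have hD : ∀ h φ, D h φ = ⟪h, J φ⟫_ℝ := fun _ _ => rfl
  have hz : IsWeakTimeDeriv T (fun t => D (y t)) z := hz
  have huti : IntegrableOn ut (Ioo 0 T) := hut.integrable le_top
  have hu_lim : Filter.Tendsto u (nhdsWithin 0 (Ioi 0)) (nhds 0) := by
    have h : Filter.Tendsto u (nhdsWithin 0 (Icc 0 T)) (nhds (u 0)) := hu 0 ⟨le_rfl, hT.le⟩
    rw [hu0] at h
    rw [← nhdsWithin_Ioo_eq_nhdsGT hT]
    exact h.mono_left (nhdsWithin_mono _ Ioo_subset_Icc_self)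
  have hG_lim : Filter.Tendsto (fun t => ∫ s in Ioo 0 t, rlKernel α s) (nhdsWithin 0 (Ioi 0))
      (nhds 0) := by
    have h : Filter.Tendsto (fun t => ∫ s in Ioo 0 t, rlKernel α s) (nhdsWithin 0 (Icc 0 T))
      (nhds (∫ s in Ioo (0 : ℝ) 0, rlKernel α s)) :=
      continuousOn_primitive_Ioo (integrableOn_rlKernel hα T) 0 ⟨le_rfl, hT.le⟩
    simp only [Ioo_self, Measure.restrict_empty, integral_zero_measure] at h
    rw [← nhdsWithin_Ioo_eq_nhdsGT hT]
    exact h.mono_left (nhdsWithin_mono _ Ioo_subset_Icc_self)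
  -- `u` is the primitive of `ut`.
  have hprim := hd.ae_eq_primitive hT huti (N := fun t => ‖u t‖) (by simpa using hu_lim.norm)
    (Filter.Eventually.of_forall fun _ => le_rfl)
  set wt : ℝ → V := fun t => Real.exp (β * t) • w t with hwt
  have hwti : IntegrableOn wt (Ioo 0 T) := by
    have hwi : IntegrableOn w (Ioo 0 T) := hw.integrable le_top
    rw [← integrableOn_Icc_iff_integrableOn_Ioo] at hwi ⊢
    exact hwi.continuousOn_smul (by fun_prop) isCompact_Icc
  -- The equation reads `(e^{βt} (A y + C u))' = -e^{βt} b(w, ·)` in the dual space.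
  have hexp : ContDiff ℝ ∞ (fun t => Real.exp (β * t)) := by fun_prop
  have hderiv : IsWeakTimeDeriv T (fun t => Real.exp (β * t) • D (A • y t + C • u t))
      (fun t => -b (wt t)) := by
    refine (((hz.const_smul A).add ((hd.clm_comp D).const_smul C)).smooth_smul hexp).congr
      (Filter.Eventually.of_forall fun t => by simp only [map_add, map_smul]) ?_
    filter_upwards [heq] with t ht
    have hde : deriv (fun t => Real.exp (β * t)) t = β * Real.exp (β * t) := by
      have := ((hasDerivAt_id t).const_mul β).exp
      simpa [mul_comm] using this.deriv
    ext φ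
    simp only [hde, hwt, add_apply, smul_apply, map_smul,
      neg_apply, smul_eq_mul, hD]
    linear_combination Real.exp (β * t) * ht φ
  have hbound : ∀ᵐ t ∂(volume.restrict (Ioo 0 T)), ‖Real.exp (β * t) • D (A • y t + C • u t)‖
      ≤ Real.exp (β * t) * (‖D‖ * (A * ((∫ s in Ioo 0 t, rlKernel α s) * M) + C * ‖u t‖)) := by
    filter_upwards [ae_restrict_mem measurableSet_Ioo] with t ht
    rw [norm_smul, Real.norm_of_nonneg (Real.exp_pos _).le]
    gcongr
    refine (D.le_opNorm _).trans ?_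
    gcongr
    refine (norm_add_le _ _).trans ?_
    rw [norm_smul, norm_smul, Real.norm_of_nonneg hA, Real.norm_of_nonneg hC.le]
    gcongr
    exact norm_laplaceConv_rlKernel_le hα ht hM
  have hN : Filter.Tendsto (fun t => Real.exp (β * t) * (‖D‖ * (A * ((∫ s in Ioo 0 t, rlKernel α s)
      * M) + C * ‖u t‖))) (nhdsWithin 0 (Ioi 0)) (nhds 0) := by
    have h1 : Filter.Tendsto (fun t => Real.exp (β * t)) (nhdsWithin 0 (Ioi 0))
        (nhds (Real.exp (β * 0))) := (hexp.continuous.tendsto 0).mono_left nhdsWithin_le_nhds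
    simpa using h1.mul ((((hG_lim.mul_const M).const_mul A).add
      (hu_lim.norm.const_mul C)).const_mul ‖D‖)
  have hbi : IntegrableOn (fun t => -b (wt t)) (Ioo 0 T) := (b.integrable_comp hwti).neg
  have hint := hderiv.ae_eq_primitive hT hbi hN hbound
  set h : ℝ → ℝ := fun t => b (∫ s in Ioo 0 t, wt s) (wt t) with hh
  have hhi : IntegrableOn h (Ioo 0 T) := by
    obtain ⟨R, hR⟩ := isCompact_Icc.exists_bound_of_continuousOn (continuousOn_primitive_Ioo hwti)
    refine b.integrable_of_bilin_of_bdd_left R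
      (((continuousOn_primitive_Ioo hwti).mono Ioo_subset_Icc_self).aestronglyMeasurable
        measurableSet_Ioo) ?_ hwti
    filter_upwards [ae_restrict_mem measurableSet_Ioo] with t ht using hR t (Ioo_subset_Icc_self ht)
  -- Evaluate the integrated equation at `wt t` and multiply by `e^{-2βt}`. The pairing with `y` is
  -- then integrated as it stands, without a weight that could spoil its sign.
  have henergy : ∀ᵐ t ∂(volume.restrict (Ioo 0 T)),
      C * ‖u t‖ ^ 2 + Real.exp (-(2 * β * t)) * h t
        = -A * ⟪∫ s in Ioo 0 t, rlKernel α (t - s) • ut s, ∫ s in Ioo 0 t, ut s⟫_ℝ := by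
    filter_upwards [hint, hwu, hprim, ae_restrict_mem measurableSet_Ioo] with t h1 h2 h3 ht
    have h4 : ∫ s in Ioo 0 t, -b (wt s) = -b (∫ s in Ioo 0 t, wt s) := by
      rw [integral_neg, b.integral_comp_comm (hwti.mono_set (Ioo_subset_Ioo_right ht.2.le))]
    rw [h4] at h1
    have h5 := congrArg (fun L => L (wt t)) h1
    simp only [smul_apply, neg_apply, hD, smul_eq_mul] at h5
    rw [← laplaceConv_eq ht.1.le, ← h3, ← hy]
    have h6 : J (wt t) = Real.exp (β * t) • u t := by simp only [hwt, map_smul, h2]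
    rw [h6, inner_smul_right, inner_add_left, inner_smul_left, inner_smul_left,
      real_inner_self_eq_norm_sq] at h5
    simp only [conj_trivial] at h5
    have h7 : Real.exp (-(2 * β * t)) * (Real.exp (β * t) * Real.exp (β * t)) = 1 := by
      rw [← Real.exp_add, ← Real.exp_add, ← Real.exp_zero]
      congr 1
      ring
    simp only [hh]
    linear_combination Real.exp (-(2 * β * t)) * h5 - (A * ⟪y t, u t⟫_ℝ + C * ‖u t‖ ^ 2) * h7
  have hsq : IntegrableOn (fun t => ‖u t‖ ^ 2) (Ioo 0 T) :=
    (ContinuousOn.integrableOn_Icc (by fun_prop)).mono_set Ioo_subset_Icc_self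
  have hwh : IntegrableOn (fun t => Real.exp (-(2 * β * t)) * h t) (Ioo 0 T) := by
    rw [← integrableOn_Icc_iff_integrableOn_Ioo] at hhi ⊢
    exact hhi.continuousOn_mul (by fun_prop) isCompact_Icc
  have htotal := integral_congr_ae henergy
  rw [integral_add (hsq.const_mul C) hwh, integral_const_mul, integral_const_mul] at htotal
  have hp1 := integral_inner_rlKernel_nonneg hα hut.1 hM
  have hp2 := integral_exp_neg_mul_nonneg hT.le (mul_nonneg zero_le_two hβ) hhi fun t ht =>
    integral_bilin_primitive_self_nonneg b hsymm hpos (hwti.mono_set (Ioo_subset_Ioo_right ht.2))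
  -- Integrate `henergy`; all three terms have a sign.
  have hzero : ∫ t in Ioo 0 T, ‖u t‖ ^ 2 = 0 := by
    have h0 : 0 ≤ ∫ t in Ioo 0 T, ‖u t‖ ^ 2 := integral_nonneg fun _ => by positivity
    have := mul_nonneg hA hp1
    nlinarith
  rw [integral_eq_zero_iff_of_nonneg (fun _ => by positivity) hsq] at hzero
  have hae : u =ᵐ[volume.restrict (Icc 0 T)] fun _ => 0 := by
    rw [← Measure.restrict_congr_set Ioo_ae_eq_Icc]
    filter_upwards [hzero] with t ht
    simpa using ht
  exact fun t ht => Measure.eqOn_Icc_of_ae_eq volume hT.ne hae hu continuousOn_const ht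

end Abstract

/-! ### The diffusion form -/

section Form

variable {d : ℕ} {Ω : Set (Space d)} {k : Space d → Matrix (Fin d) (Fin d) ℝ}

/-- The `i`-th component of a square integrable vector field. -/
noncomputable def coordL2 (Ω : Set (Space d)) (i : Fin d) : L2Vec Ω →L[ℝ] L2 Ω :=
  (EuclideanSpace.proj i : Space d →L[ℝ] ℝ).compLpL 2 (volume.restrict Ω)

lemma coeFn_coordL2 (i : Fin d) (g : L2Vec Ω) :
    coordL2 Ω i g =ᵐ[volume.restrict Ω] fun x => g x i :=
  (EuclideanSpace.proj i : Space d →L[ℝ] ℝ).coeFn_compLpL g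

/-- Multiplication by an `L^∞(Ω)` function on `L²(Ω)`. -/
noncomputable def mulL2 {m : Space d → ℝ} (hm : MemLp m ∞ (volume.restrict Ω)) : L2 Ω →L[ℝ] L2 Ω :=
  (ContinuousLinearMap.mul ℝ ℝ).holderL (volume.restrict Ω) ∞ 2 2 hm.toLp

lemma coeFn_mulL2 {m : Space d → ℝ} (hm : MemLp m ∞ (volume.restrict Ω)) (f : L2 Ω) :
    mulL2 hm f =ᵐ[volume.restrict Ω] fun x => m x * f x := by
  have h : mulL2 hm f = (ContinuousLinearMap.mul ℝ ℝ).holder 2 hm.toLp f := rfl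
  rw [h]
  filter_upwards [(ContinuousLinearMap.mul ℝ ℝ).coeFn_holder (r := 2) hm.toLp f,
    hm.coeFn_toLp] with x h1 h2
  rw [h1, h2, ContinuousLinearMap.mul_apply']

/-- The form `(v, φ) ↦ (k ∇v, ∇φ)` as a bounded bilinear form on `H¹₀(Ω)`. -/
noncomputable def diffusionForm (hk : IsAdmissibleMatrix Ω k) : H10 Ω →L[ℝ] H10 Ω →L[ℝ] ℝ :=
  ∑ i, ∑ j, (innerSL ℝ : L2 Ω →L[ℝ] L2 Ω →L[ℝ] ℝ).bilinearComp
    ((mulL2 (hk.memLp i j)).comp ((coordL2 Ω j).comp H10.grad)) ((coordL2 Ω i).comp H10.grad)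

lemma diffusionForm_apply (hk : IsAdmissibleMatrix Ω k) (v φ : H10 Ω) :
    diffusionForm hk v φ = ∫ x in Ω, ∑ i, ∑ j, k x i j * H10.grad v x j * H10.grad φ x i := by
  have h : ∀ i j, (fun x => ⟪mulL2 (hk.memLp i j) (coordL2 Ω j (H10.grad v)) x,
      coordL2 Ω i (H10.grad φ) x⟫_ℝ) =ᵐ[volume.restrict Ω]
      fun x => k x i j * H10.grad v x j * H10.grad φ x i := fun i j => by
    filter_upwards [coeFn_mulL2 (hk.memLp i j) (coordL2 Ω j (H10.grad v)),
      coeFn_coordL2 j (H10.grad v), coeFn_coordL2 i (H10.grad φ)] with x h1 h2 h3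
    rw [h1, h2, h3]
    exact mul_comm _ _
  have hi : ∀ i j, IntegrableOn (fun x => k x i j * H10.grad v x j * H10.grad φ x i) Ω :=
    fun i j => by
      have hint : IntegrableOn (fun x => ⟪mulL2 (hk.memLp i j) (coordL2 Ω j (H10.grad v)) x,
          coordL2 Ω i (H10.grad φ) x⟫_ℝ) Ω := L2.integrable_inner _ _
      exact hint.congr (h i j)
  rw [integral_finsetSum _ fun i _ => integrable_finsetSum _ fun j _ => hi i j]
  simp only [diffusionForm, sum_apply]
  refine Finset.sum_congr rfl fun i _ => ?_
  rw [integral_finsetSum _ fun j _ => hi i j]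
  refine Finset.sum_congr rfl fun j _ => ?_
  rw [← integral_congr_ae (h i j)]
  rfl

lemma formL_eq (hk : IsAdmissibleMatrix Ω k) (a : ℝ) (v φ : H10 Ω) :
    formL k a v φ = diffusionForm hk v φ + a * ⟪H10.val v, H10.val φ⟫_ℝ := by
  rw [formL, diffusionForm_apply]

lemma diffusionForm_symm (hk : IsAdmissibleMatrix Ω k) (v φ : H10 Ω) :
    diffusionForm hk v φ = diffusionForm hk φ v := by
  rw [diffusionForm_apply, diffusionForm_apply]
  refine integral_congr_ae ?_
  filter_upwards [hk.symm] with x hx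
  rw [Finset.sum_comm]
  refine Finset.sum_congr rfl fun j _ => Finset.sum_congr rfl fun i _ => ?_
  rw [hx.apply j i]
  ring

lemma diffusionForm_self_nonneg (hk : IsAdmissibleMatrix Ω k) (v : H10 Ω) :
    0 ≤ diffusionForm hk v v := by
  obtain ⟨k₀, hk₀, hell⟩ := hk.elliptic
  rw [diffusionForm_apply]
  refine integral_nonneg_of_ae ?_
  filter_upwards [hell] with x hx
  refine (by positivity : 0 ≤ k₀ * ‖H10.grad v x‖ ^ 2).trans ((hx (H10.grad v x)).trans_eq ?_)
  refine Finset.sum_congr rfl fun i _ => Finset.sum_congr rfl fun j _ => ?_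
  ring

end Form

end SPL

theorem mainTheorem2 {d : ℕ} (Ω : Set (SPL.Space d)) (hΩ : IsOpen Ω)
    (hΩb : Bornology.IsBounded Ω)
    (T α ρ c τq a : ℝ) (hT : 0 < T) (hα : α ∈ Set.Ioo (0 : ℝ) 1)
    (hρ : 0 < ρ) (hc : 0 < c) (hτq : 0 < τq) (ha : 0 ≤ a)
    (k : SPL.Space d → Matrix (Fin d) (Fin d) ℝ) (hk : SPL.IsAdmissibleMatrix Ω k)
    (F : ℝ → SPL.L2 Ω) (U₀ V₀ : SPL.L2 Ω) (u₁ u₂ : ℝ → SPL.L2 Ω)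
    (hu₁ : SPL.IsWeakSolution Ω T α ρ c τq a k F U₀ V₀ u₁)
    (hu₂ : SPL.IsWeakSolution Ω T α ρ c τq a k F U₀ V₀ u₂)
    (hu₁' : ∃ ut : ℝ → SPL.L2 Ω, SPL.IsWeakTimeDeriv T u₁ ut ∧ SPL.MemLpTime ∞ T ut)
    (hu₂' : ∃ ut : ℝ → SPL.L2 Ω, SPL.IsWeakTimeDeriv T u₂ ut ∧ SPL.MemLpTime ∞ T ut) :
    ∀ t ∈ Set.Icc 0 T, u₁ t = u₂ t := by
  obtain ⟨hc₁, h0₁, w₁, ut₁, z₁, hw₁, hwu₁, -, hd₁, -, hz₁, heq₁⟩ := hu₁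
  obtain ⟨hc₂, h0₂, w₂, ut₂, z₂, hw₂, hwu₂, -, hd₂, -, hz₂, heq₂⟩ := hu₂
  have hut : ∀ {u ut : ℝ → SPL.L2 Ω}, SPL.IsWeakTimeDeriv T u ut →
      (∃ ut : ℝ → SPL.L2 Ω, SPL.IsWeakTimeDeriv T u ut ∧ SPL.MemLpTime ∞ T ut) →
      SPL.MemLpTime ∞ T ut := fun hd h => by
    obtain ⟨ut', hd', hm⟩ := h
    exact hm.ae_eq (hd'.ae_unique hd)
  have hut₁ := hut hd₁ hu₁'
  have hut₂ := hut hd₂ hu₂'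
  have hconst : SPL.MemLpTime ∞ T (fun _ : ℝ => V₀) := memLp_const V₀
  have hβ : a = a / (ρ * c) * (ρ * c) := by field_simp
  have hconv : ∀ t ∈ Ioo 0 T, SPL.laplaceConv (SPL.rlKernel α) (fun s => ut₁ s - ut₂ s) t
      = SPL.laplaceConv (SPL.rlKernel α) ut₁ t - SPL.laplaceConv (SPL.rlKernel α) ut₂ t :=
    fun t ht => SPL.laplaceConv_rlKernel_sub hα ht hut₁ hut₂
  -- The difference solves the homogeneous equation; the term `a (u, φ)` of the form is `βC (u, φ)`.
  have key := SPL.eq_zero_of_energy (T := T) (α := α) (A := ρ * c * τq ^ α) (C := ρ * c)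
    (β := a / (ρ * c)) (u := fun t => u₁ t - u₂ t) (ut := fun t => ut₁ t - ut₂ t)
    (w := fun t => w₁ t - w₂ t) (z := fun t => z₁ t - z₂ t)
    (SPL.H10.val (Ω := Ω)) (SPL.diffusionForm hk)
    (SPL.diffusionForm_symm hk) (SPL.diffusionForm_self_nonneg hk) hT hα (by positivity)
    (by positivity) (by positivity) (hc₁.sub hc₂) (by simp [h0₁, h0₂]) (hw₁.sub hw₂)
    (by filter_upwards [hwu₁, hwu₂] with t h1 h2 using by rw [map_sub, h1, h2])
    (hut₁.sub hut₂) (hd₁.sub hd₂) ?_ ?_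
  · exact fun t ht => sub_eq_zero.1 (key t ht)
  · refine (hz₁.sub hz₂).congr ?_ (Filter.Eventually.of_forall fun _ => rfl)
    filter_upwards [ae_restrict_mem measurableSet_Ioo] with t ht
    rw [SPL.laplaceConv_rlKernel_sub hα ht hut₁ hconst,
      SPL.laplaceConv_rlKernel_sub hα ht hut₂ hconst, hconv t ht]
    ext φ
    simp only [SPL.L2.toDual, sub_apply, ContinuousLinearMap.comp_apply, map_sub]
    ring
  · filter_upwards [heq₁, heq₂, hwu₁, hwu₂, ae_restrict_mem measurableSet_Ioo]
      with t h1 h2 h3 h4 ht φ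
    have e1 := h1 φ
    have e2 := h2 φ
    rw [SPL.formL_eq hk, h3] at e1
    rw [SPL.formL_eq hk, h4] at e2
    simp only [hconv t ht, inner_sub_left, sub_apply, map_sub]
    rw [← hβ, show a / (ρ * c) * (ρ * c * τq ^ α) = a * τq ^ α by field_simp]
    linear_combination e1 - e2
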